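/- Let $X\sim\mathcal N(m_X,C_X)$ in $\mathbb{R}^q$ and $\varepsilon\sim\mathcal N(m_E,C_E)$ in $\mathbb{R}^n$ be independent Gaussian random vectors with symmetric positive definite covariance matrices $C_X$ and $C_E$, let $B\in\mathbb{R}^{n\times q}$ and $Y=BX+\varepsilon$. Put $C_A=BC_XB^T$ and $C_Y=C_A+C_E$. For random vectors $Z_0,Z_1$ let $\mathcal I(Z_0,Z_1)=H(Z_0)+H(Z_1)-H(Z_0,Z_1)$ be the mutual information, where $H(Z)=\mathbb E(-\log f_Z(Z))$ is the entropy and $f_Z$ is the density of $Z$ with respect to the Lebesgue measure. Let $V\in\mathbb{R}^{n\times r}$ be any solution to $\max_U\mathcal I(U^TY,X)$, the maximum being over all $U\in\mathbb{R}^{n\times r}$ of rank $r$, and let $W=V^TY$. Let $\lambda_1\ge\dots\ge\lambda_n$ and $\nu_1\ge\dots\ge\nu_n$ be the eigenvalues, counted with multiplicity, of the generalized eigenvalue problems $C_Yv=\lambda C_Ev$ and $C_Av=\nu C_Ev$, respectively, and let $m$ be the rank of $B$. Then all the entropies involved are well defined and finite, $m\le q$, $C_A$ has rank $m$, and $\nu_i\ge0$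 and $\lambda_i=1+\nu_i$ for all $i$. If $m>0$, then $\mathcal I(Y,X)>0$, $\sum_{i=1}^m\log(1+\nu_i)>0$, and $$\frac{\mathcal I(Y,X)-\mathcal I(W,X)}{\mathcal I(Y,X)}=1-\frac{\sum_{i=1}^r\log(1+\nu_i)}{\sum_{i=1}^m\log(1+\nu_i)}.$$ If $r\ge m$ (in particular if $r=q$), then $\mathcal I(W,X)=\mathcal I(Y,X)$. -/

import Mathlib

open MeasureTheory ProbabilityTheory Matrix

namespace GaussianReduction

/-- The differential entropy `H(Z) = E(-log f_Z(Z))`, where `f_Z` is the density of the law of `Z`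
with respect to the Lebesgue measure. -/
noncomputable def entropy {Ω E : Type*} [MeasurableSpace Ω] [MeasureSpace E]
    (P : Measure Ω) (Z : Ω → E) : ℝ :=
  ∫ ω, -Real.log (pdf Z P volume (Z ω)).toReal ∂P

/-- The entropy of `Z` is well defined and finite: `Z` has a density with respect to the Lebesgue
measure, and `log f_Z(Z)` is integrable. -/
def HasFiniteEntropy {Ω E : Type*} [MeasurableSpace Ω] [MeasureSpace E]
    (P : Measure Ω) (Z : Ω → E) : Prop :=
  HasPDF Z P volume ∧ Integrable (fun ω => Real.log (pdf Z P volume (Z ω)).toReal) P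

/-- The mutual information `I(Z₀, Z₁) = H(Z₀) + H(Z₁) - H(Z₀, Z₁)`. -/
noncomputable def mutualInfo {Ω E F : Type*} [MeasurableSpace Ω] [MeasureSpace E] [MeasureSpace F]
    (P : Measure Ω) (Z₀ : Ω → E) (Z₁ : Ω → F) : ℝ :=
  entropy P Z₀ + entropy P Z₁ - entropy P (fun ω => (Z₀ ω, Z₁ ω))

/-- The linear model with additive noise, `Y = B X + ε`. -/
noncomputable def linearModel {Ω : Type*} {n q : ℕ} (B : Matrix (Fin n) (Fin q) ℝ)
    (X : Ω → EuclideanSpace ℝ (Fin q)) (ε : Ω → EuclideanSpace ℝ (Fin n)) :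
    Ω → EuclideanSpace ℝ (Fin n) :=
  fun ω => WithLp.toLp 2 (B *ᵥ (X ω).ofLp) + ε ω

/-- The reduced observations `W = Vᵀ Y`. -/
noncomputable def reduced {Ω : Type*} {n r : ℕ} (V : Matrix (Fin n) (Fin r) ℝ)
    (Y : Ω → EuclideanSpace ℝ (Fin n)) : Ω → EuclideanSpace ℝ (Fin r) :=
  fun ω => WithLp.toLp 2 (Vᵀ *ᵥ (Y ω).ofLp)

/-- `V` has full (column) rank `r` and maximizes `U ↦ I(Uᵀ Y, X)` among the `n × r` matrices of
full rank. -/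
def IsMIOptimal {Ω : Type*} [MeasurableSpace Ω] {n q r : ℕ} (P : Measure Ω)
    (Y : Ω → EuclideanSpace ℝ (Fin n)) (X : Ω → EuclideanSpace ℝ (Fin q))
    (V : Matrix (Fin n) (Fin r) ℝ) : Prop :=
  V.rank = r ∧
    IsMaxOn (fun U : Matrix (Fin n) (Fin r) ℝ => mutualInfo P (reduced U Y) X) {U | U.rank = r} V

/-- `μ₁ ≥ … ≥ μₙ` are the eigenvalues, counted with multiplicity and sorted in decreasing order, of
the generalized eigenvalue problem `A v = μ C v`: some basis of `ℝⁿ` consists of eigenvectors `vᵢ`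
associated to the `μᵢ`. -/
def IsSortedGenEigenvalues {n : ℕ} (A C : Matrix (Fin n) (Fin n) ℝ) (μ : Fin n → ℝ) : Prop :=
  Antitone μ ∧ ∃ v : Fin n → (Fin n → ℝ), LinearIndependent ℝ v ∧
    ∀ i, A *ᵥ v i = μ i • (C *ᵥ v i)

end GaussianReduction

open GaussianReduction

/-! For `U` of rank `r`, `UᵀY = UᵀBX + UᵀE` with `E` the noise, and the shear `(w, x) ↦ (w + UᵀBx,
x)` preserves Lebesgue measure. Hence `H(UᵀY, X) = H(UᵀE) + H(X)` and `I(UᵀY, X) = H(UᵀY) - H(UᵀE)`.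
A Gaussian entropy is a constant of the dimension plus half the log-determinant of the covariance,
so `I(UᵀY, X) = ½ log (det(Uᵀ C_Y U) / det(Uᵀ C_E U))` (`mutualInfo_reduced_linearModel`).

Some `M` satisfies `Mᵀ C_E M = 1` and `Mᵀ C_Y M = diag(1 + ν)`. With `U = MQ`, the Cauchy–Binet
formula bounds the ratio by the product of the `r` largest `1 + νᵢ` (`det_compression_le`), and the
first `r` columns of `M` attain it. Thus `I(W, X) = ½ ∑_{i ≤ r} log(1 + νᵢ)`, while `U = 1` gives
the full sum for `I(Y, X)`. Since `C_A` has rank `m` and `ν ≥ 0` is decreasing, `νᵢ` vanishes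
exactly for `i > m`, so the full sum stops at `m`. -/

namespace GaussianReduction

/-! ### Generalized eigenvalue problems -/

/-- Antitone families with the same multiset of values coincide. -/
lemma antitone_eq_of_map_eq {n : ℕ} {f g : Fin n → ℝ} (hf : Antitone f) (hg : Antitone g)
    (h : Finset.univ.val.map f = Finset.univ.val.map g) : f = g := by
  apply List.ofFn_injective
  apply List.Perm.eq_of_sortedGE hf.sortedGE_ofFn hg.sortedGE_ofFn
  rw [← Multiset.coe_eq_coe]
  simpa [Fin.univ_val_map] using h

/-- The eigenvector basis makes `C⁻¹A` similar to `diagonal μ`. The roots of this polynomial do not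
depend on the basis, hence the uniqueness of `μ`. -/
lemma IsSortedGenEigenvalues.charpoly_eq {n : ℕ} {A C : Matrix (Fin n) (Fin n) ℝ} {μ : Fin n → ℝ}
    (hC : IsUnit C.det) (h : IsSortedGenEigenvalues A C μ) :
    (C⁻¹ * A).charpoly = ∏ i, (Polynomial.X - Polynomial.C (μ i)) := by
  obtain ⟨-, v, hv, hA⟩ := h
  set M : Matrix (Fin n) (Fin n) ℝ := (Matrix.of v)ᵀ with hM
  have hMu : IsUnit M := by
    rw [hM, Matrix.isUnit_transpose]
    exact Matrix.linearIndependent_rows_iff_isUnit.1 hv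
  have hMdet := (Matrix.isUnit_iff_isUnit_det _).1 hMu
  have h1 : A * M = C * M * diagonal μ := by
    ext i j
    rw [mul_diagonal]
    have := congrFun (hA j) i
    simp only [Pi.smul_apply, smul_eq_mul] at this
    rw [mul_comm]
    exact this
  have h2 : C⁻¹ * A = M * (diagonal μ * M⁻¹) := by
    have : A = C * M * diagonal μ * M⁻¹ := by
      rw [← h1, Matrix.mul_assoc, Matrix.mul_nonsing_inv _ hMdet, Matrix.mul_one]
    rw [this]
    simp only [Matrix.mul_assoc]
    rw [Matrix.nonsing_inv_mul_cancel_left _ _ hC]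
  rw [h2, charpoly_mul_comm, Matrix.mul_assoc, Matrix.nonsing_inv_mul _ hMdet, Matrix.mul_one,
    charpoly_diagonal]

lemma IsSortedGenEigenvalues.unique {n : ℕ} {A C : Matrix (Fin n) (Fin n) ℝ} {μ μ' : Fin n → ℝ}
    (hC : IsUnit C.det) (h : IsSortedGenEigenvalues A C μ) (h' : IsSortedGenEigenvalues A C μ') :
    μ = μ' := by
  apply antitone_eq_of_map_eq h.1 h'.1
  have := congrArg Polynomial.roots ((h.charpoly_eq hC).symm.trans (h'.charpoly_eq hC))
  rw [Polynomial.roots_prod _ _ (Finset.prod_ne_zero_iff.2 fun i _ => Polynomial.X_sub_C_ne_zero _),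
    Polynomial.roots_prod _ _ (Finset.prod_ne_zero_iff.2 fun i _ => Polynomial.X_sub_C_ne_zero _)]
    at this
  simpa [Multiset.bind_singleton] using this

lemma exists_orthogonal_diagonalization {n : ℕ} {A : Matrix (Fin n) (Fin n) ℝ}
    (hA : A.IsHermitian) :
    ∃ U : Matrix (Fin n) (Fin n) ℝ, Uᵀ * U = 1 ∧ Uᵀ * A * U = diagonal hA.eigenvalues := by
  let U : Matrix (Fin n) (Fin n) ℝ := hA.eigenvectorUnitary
  have hU : Uᵀ * U = 1 := Unitary.coe_star_mul_self hA.eigenvectorUnitary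
  refine ⟨U, hU, ?_⟩
  have h := hA.spectral_theorem
  rw [Unitary.conjStarAlgAut_apply] at h
  change A = U * diagonal hA.eigenvalues * Uᵀ at h
  calc Uᵀ * A * U = Uᵀ * (U * diagonal hA.eigenvalues * Uᵀ) * U := by rw [← h]
    _ = (Uᵀ * U) * diagonal hA.eigenvalues * (Uᵀ * U) := by simp only [Matrix.mul_assoc]
    _ = _ := by rw [hU]; simp

/-- A congruence `S` first turns `C` into the identity; an orthogonal matrix that diagonalizes
`SᵀAS` then leaves the identity unchanged. -/
lemma exists_simultaneous_diagonalization {n : ℕ} {A C : Matrix (Fin n) (Fin n) ℝ}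
    (hA : A.IsHermitian) (hC : C.PosDef) :
    ∃ (M : Matrix (Fin n) (Fin n) ℝ) (μ : Fin n → ℝ), Antitone μ ∧ Mᵀ * C * M = 1 ∧
      Mᵀ * A * M = diagonal μ := by
  obtain ⟨S, hS⟩ : ∃ S : Matrix (Fin n) (Fin n) ℝ, Sᵀ * C * S = 1 := by
    have hCi := hC.isHermitian
    obtain ⟨U, hU, hspec⟩ := exists_orthogonal_diagonalization hCi
    let d : Fin n → ℝ := fun i => (√(hCi.eigenvalues i))⁻¹
    have key : (U * diagonal d)ᵀ * C * (U * diagonal d) = 1 := by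
      calc (U * diagonal d)ᵀ * C * (U * diagonal d)
          = diagonal d * (Uᵀ * C * U) * diagonal d := by
            simp only [Matrix.transpose_mul, Matrix.diagonal_transpose, Matrix.mul_assoc]
        _ = 1 := by
            rw [hspec, diagonal_mul_diagonal, diagonal_mul_diagonal, ← diagonal_one]
            congr 1
            funext i
            have hp : 0 < √(hCi.eigenvalues i) := Real.sqrt_pos.2 (hC.eigenvalues_pos i)
            have hq := Real.mul_self_sqrt (hC.eigenvalues_pos i).le
            simp only [d]
            field_simp
            nlinarith
    exact ⟨U * diagonal d, key⟩
  have hK : (Sᵀ * A * S).IsHermitian := by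
    simpa using isHermitian_conjTranspose_mul_mul S hA
  obtain ⟨U, hU, hspec⟩ := exists_orthogonal_diagonalization hK
  -- Sorting the negatives puts the eigenvalues in decreasing order; the columns of `S * U` are
  -- permuted accordingly.
  let σ := Tuple.sort (fun i => -hK.eigenvalues i)
  refine ⟨(S * U).submatrix id σ, hK.eigenvalues ∘ σ, ?_, ?_, ?_⟩
  · intro i j hij
    have := Tuple.monotone_sort (fun i => -hK.eigenvalues i) hij
    simpa using this
  · have : (S * U)ᵀ * C * (S * U) = 1 := by
      calc _ = Uᵀ * (Sᵀ * C * S) * U := by simp only [Matrix.transpose_mul, Matrix.mul_assoc]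
        _ = 1 := by rw [hS, Matrix.mul_one, hU]
    rw [← Matrix.submatrix_id_id C, Matrix.transpose_submatrix]
    have h := congrArg (fun N => N.submatrix σ σ) this
    simp only [Matrix.submatrix_one_equiv] at h
    rw [← h]
    ext; simp [Matrix.mul_apply, Matrix.submatrix_apply]
  · have : (S * U)ᵀ * A * (S * U) = diagonal hK.eigenvalues := by
      rw [← hspec]
      simp only [Matrix.transpose_mul, Matrix.mul_assoc]
    have h := congrArg (fun N => N.submatrix σ σ) this
    simp only [Matrix.submatrix_diagonal_equiv] at h
    rw [← h]
    ext; simp [Matrix.mul_apply, Matrix.submatrix_apply]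

lemma IsSortedGenEigenvalues.of_diagonalization {n : ℕ} {A C M : Matrix (Fin n) (Fin n) ℝ}
    {μ : Fin n → ℝ} (hμ : Antitone μ) (hC : Mᵀ * C * M = 1) (hA : Mᵀ * A * M = diagonal μ) :
    IsSortedGenEigenvalues A C μ := by
  have hM : IsUnit M.det := Matrix.isUnit_det_of_left_inverse hC
  have hMt : IsUnit Mᵀ.det := by rwa [Matrix.det_transpose]
  have h1 : A * M = C * M * diagonal μ := by
    have : Mᵀ * (A * M) = Mᵀ * (C * M * diagonal μ) := by
      rw [← Matrix.mul_assoc, hA, ← Matrix.mul_assoc, ← Matrix.mul_assoc, hC, Matrix.one_mul]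
    rw [← Matrix.nonsing_inv_mul_cancel_left Mᵀ (A * M) hMt, this,
      Matrix.nonsing_inv_mul_cancel_left Mᵀ _ hMt]
  refine ⟨hμ, Mᵀ, ?_, fun i => ?_⟩
  · exact Matrix.linearIndependent_rows_iff_isUnit.2 ((Matrix.isUnit_iff_isUnit_det _).2 hMt)
  · funext j
    have := congrFun (congrFun h1 j) i
    rw [mul_diagonal, mul_comm] at this
    exact this

/-- The eigenvectors in `h` need not be `C`-orthonormal, so another basis is taken and uniqueness
identifies its eigenvalues with `μ`. -/
lemma IsSortedGenEigenvalues.exists_diagonalization {n : ℕ} {A C : Matrix (Fin n) (Fin n) ℝ}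
    {μ : Fin n → ℝ} (hA : A.IsHermitian) (hC : C.PosDef) (h : IsSortedGenEigenvalues A C μ) :
    ∃ M : Matrix (Fin n) (Fin n) ℝ, Mᵀ * C * M = 1 ∧ Mᵀ * A * M = diagonal μ := by
  obtain ⟨M, μ', hμ', h1, h2⟩ := exists_simultaneous_diagonalization hA hC
  rw [h.unique (isUnit_iff_ne_zero.2 hC.det_pos.ne') (.of_diagonalization hμ' h1 h2)]
  exact ⟨M, h1, h2⟩

lemma IsSortedGenEigenvalues.add {n : ℕ} {A C : Matrix (Fin n) (Fin n) ℝ} {μ : Fin n → ℝ}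
    (h : IsSortedGenEigenvalues A C μ) : IsSortedGenEigenvalues (A + C) C (fun i => 1 + μ i) := by
  obtain ⟨hμ, v, hv, hA⟩ := h
  refine ⟨fun i j hij => add_le_add_right (hμ hij) 1, v, hv, fun i => ?_⟩
  rw [add_mulVec, hA i, add_smul, one_smul, add_comm]

/-! ### Maximizing the ratio of compressed determinants -/

/-- The symmetric form of the Cauchy–Binet formula. -/
lemma factorial_mul_det_transpose_mul_diagonal_mul {n r : ℕ} (Q : Matrix (Fin n) (Fin r) ℝ)
    (d : Fin n → ℝ) :
    (r.factorial : ℝ) * (Qᵀ * diagonal d * Q).det =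
      ∑ f : Fin r → Fin n, (∏ j, d (f j)) * (Q.submatrix f id).det ^ 2 := by
  have expand : (Qᵀ * diagonal d * Q).det =
      ∑ f : Fin r → Fin n, (∏ j, d (f j)) * (∏ j, Q (f j) j) * (Q.submatrix f id).det := by
    have h1 : ∀ i j, (Qᵀ * diagonal d * Q) i j = ∑ k, (Q k i * d k) * Q k j := by
      intro i j
      rw [Matrix.mul_apply]
      simp only [Matrix.mul_diagonal, Matrix.transpose_apply]
    rw [← Matrix.det_transpose, Matrix.det_apply']
    simp only [Matrix.transpose_apply, h1]
    simp_rw [Finset.prod_univ_sum, Fintype.piFinset_univ, Finset.mul_sum]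
    rw [Finset.sum_comm]
    refine Finset.sum_congr rfl fun f _ => ?_
    rw [← Matrix.det_transpose, Matrix.det_apply', Finset.mul_sum]
    refine Finset.sum_congr rfl fun σ _ => ?_
    simp only [Matrix.transpose_apply, Matrix.submatrix_apply, id, Finset.prod_mul_distrib]
    ring
  -- Relabelling `f` as `f ∘ σ` multiplies the minor by the sign of `σ`. Summing over all `σ` turns
  -- `∏ j, Q (f j) j` into a second copy of the minor and produces the factor `r!`.
  have perm : ∀ σ : Equiv.Perm (Fin r), (Qᵀ * diagonal d * Q).det =
      ∑ f : Fin r → Fin n, (∏ j, d (f j)) *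
        ((Equiv.Perm.sign σ : ℤ) * ∏ j, Q (f (σ j)) j) * (Q.submatrix f id).det := by
    intro σ
    rw [expand, ← (Equiv.arrowCongr σ (Equiv.refl (Fin n))).symm.sum_comp]
    refine Finset.sum_congr rfl fun f _ => ?_
    have h2 : (Equiv.arrowCongr σ (Equiv.refl (Fin n))).symm f = f ∘ σ := by
      ext; simp [Equiv.arrowCongr]
    rw [h2]
    have h3 : (Q.submatrix (f ∘ σ) id).det = (Equiv.Perm.sign σ : ℤ) * (Q.submatrix f id).det := by
      rw [← Matrix.det_permute]; rfl
    rw [h3]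
    have h4 : ∏ j, d ((f ∘ σ) j) = ∏ j, d (f j) := Equiv.prod_comp σ (fun j => d (f j))
    rw [h4]
    simp only [Function.comp]
    ring
  have hsum : (r.factorial : ℝ) * (Qᵀ * diagonal d * Q).det =
      ∑ _σ : Equiv.Perm (Fin r), (Qᵀ * diagonal d * Q).det := by
    simp [Fintype.card_perm]
  rw [hsum, Finset.sum_congr rfl fun σ _ => perm σ, Finset.sum_comm]
  refine Finset.sum_congr rfl fun f _ => ?_
  rw [← Finset.sum_mul, ← Finset.mul_sum, pow_two, ← mul_assoc]
  congr 2
  rw [Matrix.det_apply']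
  rfl

lemma prod_comp_le_of_injective {n r : ℕ} {d : Fin n → ℝ} (hd : Antitone d) (h0 : ∀ i, 0 ≤ d i)
    (hr : r ≤ n) {f : Fin r → Fin n} (hf : Function.Injective f) :
    ∏ j, d (f j) ≤ ∏ j : Fin r, d (Fin.castLE hr j) := by
  have hc : (Finset.univ.image f).card = r := by
    rw [Finset.card_image_of_injective _ hf]; simp
  let e := (Finset.univ.image f).orderEmbOfFin hc
  -- The increasing enumeration `e` of the range of `f` satisfies `j ≤ e j`, so `d` can be compared
  -- factor by factor.
  have h1 : ∏ j, d (f j) = ∏ j, d (e j) := by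
    rw [← Finset.prod_image (s := Finset.univ) (g := f) (f := d) hf.injOn,
      ← Finset.prod_image (s := Finset.univ) (g := e) (f := d) e.injective.injOn,
      Finset.image_orderEmbOfFin_univ]
  rw [h1]
  refine Finset.prod_le_prod (fun i _ => h0 _) fun i _ => hd ?_
  have hle : ∀ k (hk : k < r), k ≤ (e ⟨k, hk⟩ : ℕ) := by
    intro k
    induction k with
    | zero => intro _; exact Nat.zero_le _
    | succ k ih =>
      intro hk
      have := ih (by omega)
      have h3 : e ⟨k, by omega⟩ < e ⟨k + 1, hk⟩ := e.strictMono (by simp)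
      have h4 : (e ⟨k, by omega⟩ : ℕ) < e ⟨k + 1, hk⟩ := h3
      omega
  exact hle i i.2

/-- Cauchy–Binet for `d` and for the constant `1` are compared term by term; a non-injective `f`
repeats a row and contributes zero. -/
lemma det_transpose_mul_diagonal_mul_le {n r : ℕ} (Q : Matrix (Fin n) (Fin r) ℝ) {d : Fin n → ℝ}
    (hd : Antitone d) (h0 : ∀ i, 0 ≤ d i) (hr : r ≤ n) :
    (Qᵀ * diagonal d * Q).det ≤ (∏ j : Fin r, d (Fin.castLE hr j)) * (Qᵀ * Q).det := by
  have h1 := factorial_mul_det_transpose_mul_diagonal_mul Q d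
  have h2 := factorial_mul_det_transpose_mul_diagonal_mul Q (fun _ => 1)
  simp only [diagonal_one, Matrix.mul_one, Finset.prod_const_one, one_mul] at h2
  have hpos : (0 : ℝ) < r.factorial := by exact_mod_cast r.factorial_pos
  refine le_of_mul_le_mul_left ?_ hpos
  rw [h1, mul_left_comm, h2, Finset.mul_sum]
  refine Finset.sum_le_sum fun f _ => ?_
  by_cases hf : Function.Injective f
  · exact mul_le_mul_of_nonneg_right (prod_comp_le_of_injective hd h0 hr hf) (sq_nonneg _)
  · obtain ⟨i, j, hij, hne⟩ : ∃ i j, f i = f j ∧ i ≠ j := by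
      simpa [Function.Injective] using hf
    have : (Q.submatrix f id).det = 0 :=
      Matrix.det_zero_of_row_eq hne (by ext k; simp [hij])
    simp [this]

lemma det_compression_le {n r : ℕ} {N C M : Matrix (Fin n) (Fin n) ℝ} {d : Fin n → ℝ}
    (hd : Antitone d) (h0 : ∀ i, 0 ≤ d i) (hC : Mᵀ * C * M = 1) (hN : Mᵀ * N * M = diagonal d)
    (hr : r ≤ n) (U : Matrix (Fin n) (Fin r) ℝ) :
    (Uᵀ * N * U).det ≤ (∏ j : Fin r, d (Fin.castLE hr j)) * (Uᵀ * C * U).det := by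
  have hM : IsUnit M.det := Matrix.isUnit_det_of_left_inverse hC
  have hU : U = M * (M⁻¹ * U) := (Matrix.mul_nonsing_inv_cancel_left M U hM).symm
  have conj : ∀ K : Matrix (Fin n) (Fin n) ℝ,
      Uᵀ * K * U = (M⁻¹ * U)ᵀ * (Mᵀ * K * M) * (M⁻¹ * U) := by
    intro K
    conv_lhs => rw [hU]
    simp only [Matrix.transpose_mul, Matrix.mul_assoc]
  rw [conj N, conj C, hN, hC, Matrix.mul_one]
  exact det_transpose_mul_diagonal_mul_le _ hd h0 hr

/-- The witness consists of the first `r` columns of `M`. -/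
lemma exists_det_compression_eq {n r : ℕ} {N C M : Matrix (Fin n) (Fin n) ℝ} {d : Fin n → ℝ}
    (hC : Mᵀ * C * M = 1) (hN : Mᵀ * N * M = diagonal d) (hr : r ≤ n) :
    ∃ U : Matrix (Fin n) (Fin r) ℝ, U.rank = r ∧ (Uᵀ * C * U).det = 1 ∧
      (Uᵀ * N * U).det = ∏ j : Fin r, d (Fin.castLE hr j) := by
  have hsub : ∀ K : Matrix (Fin n) (Fin n) ℝ,
      (M.submatrix id (Fin.castLE hr))ᵀ * K * M.submatrix id (Fin.castLE hr) =
        (Mᵀ * K * M).submatrix (Fin.castLE hr) (Fin.castLE hr) := by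
    intro K
    ext
    simp [Matrix.mul_apply]
  have hinj : Function.Injective (Fin.castLE hr) := Fin.castLE_injective hr
  have h1 : (M.submatrix id (Fin.castLE hr))ᵀ * C * M.submatrix id (Fin.castLE hr) = 1 := by
    rw [hsub, hC, Matrix.submatrix_one _ hinj]
  refine ⟨M.submatrix id (Fin.castLE hr), le_antisymm (rank_le_width _) ?_, ?_, ?_⟩
  · have := Matrix.rank_mul_le_right ((M.submatrix id (Fin.castLE hr))ᵀ * C)
      (M.submatrix id (Fin.castLE hr))
    rwa [h1, Matrix.rank_one, Fintype.card_fin] at this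
  · rw [h1, det_one]
  · rw [hsub, hN, Matrix.submatrix_diagonal _ _ hinj, det_diagonal]
    rfl

/-! ### Ranks and vanishing eigenvalues -/

lemma mulVec_injective_of_rank_eq {n r : ℕ} {U : Matrix (Fin n) (Fin r) ℝ} (hU : U.rank = r) :
    Function.Injective U.mulVec := by
  rw [Matrix.mulVec_injective_iff, linearIndependent_iff_card_eq_finrank_span,
    Fintype.card_fin, Set.finrank, ← Matrix.rank_eq_finrank_span_cols, hU]

lemma rank_eq_card_of_diagonalization {n : ℕ} {A M : Matrix (Fin n) (Fin n) ℝ} {μ : Fin n → ℝ}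
    (hM : IsUnit M.det) (hA : Mᵀ * A * M = diagonal μ) :
    A.rank = (Finset.univ.filter fun i => μ i ≠ 0).card := by
  have hMt : IsUnit Mᵀ.det := by rwa [Matrix.det_transpose]
  have h := Matrix.rank_diagonal μ
  rw [← hA, Matrix.rank_mul_eq_left_of_isUnit_det _ _ hM,
    Matrix.rank_mul_eq_right_of_isUnit_det _ _ hMt, Fintype.card_subtype] at h
  exact h

/-- Writing `C = N Nᵀ` with `N` invertible gives `(BN)(BN)ᵀ`, whose rank is that of `BN`, hence of
`B`. -/
lemma rank_mul_mul_transpose_of_posDef {n q : ℕ} (B : Matrix (Fin n) (Fin q) ℝ)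
    {C : Matrix (Fin q) (Fin q) ℝ} (hC : C.PosDef) : (B * C * Bᵀ).rank = B.rank := by
  obtain ⟨M, -, -, h1, -⟩ := exists_simultaneous_diagonalization hC.isHermitian hC
  have hM : IsUnit M.det := Matrix.isUnit_det_of_left_inverse h1
  have hMt : IsUnit Mᵀ.det := by rwa [Matrix.det_transpose]
  have hCM : C = Mᵀ⁻¹ * (Mᵀ⁻¹)ᵀ := by
    rw [Matrix.transpose_nonsing_inv, Matrix.transpose_transpose]
    calc C = Mᵀ⁻¹ * (Mᵀ * C * M) * M⁻¹ := by
          rw [Matrix.mul_assoc Mᵀ, Matrix.nonsing_inv_mul_cancel_left _ _ hMt,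
            Matrix.mul_nonsing_inv_cancel_right _ _ hM]
      _ = _ := by rw [h1, Matrix.mul_one]
  have h2 : B * C * Bᵀ = (B * Mᵀ⁻¹) * (B * Mᵀ⁻¹)ᵀ := by
    conv_lhs => rw [hCM]
    simp only [Matrix.transpose_mul, Matrix.mul_assoc]
  rw [h2, Matrix.rank_self_mul_transpose, Matrix.rank_mul_eq_left_of_isUnit_det]
  exact (Matrix.isUnit_nonsing_inv_det_iff).2 hMt

/-- The nonzero values occupy an initial segment of length `m`; indices start at `0`, hence `m ≤ i`.
-/
lemma eq_zero_iff_of_antitone_of_card {n m : ℕ} {μ : Fin n → ℝ} (hμ : Antitone μ)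
    (h0 : ∀ i, 0 ≤ μ i) (hm : (Finset.univ.filter fun i => μ i ≠ 0).card = m) (i : Fin n) :
    μ i = 0 ↔ m ≤ i := by
  constructor
  · intro hi
    have hsub : (Finset.univ.filter fun j => μ j ≠ 0) ⊆ Finset.Iio i := by
      intro j hj
      rw [Finset.mem_filter] at hj
      rw [Finset.mem_Iio]
      by_contra hle
      exact hj.2 (le_antisymm ((hμ (not_lt.1 hle)).trans hi.le) (h0 j))
    have := Finset.card_le_card hsub
    rwa [hm, Fin.card_Iio] at this
  · intro hi
    by_contra hne
    have hsub : Finset.Iic i ⊆ (Finset.univ.filter fun j => μ j ≠ 0) := by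
      intro j hj
      rw [Finset.mem_Iic] at hj
      rw [Finset.mem_filter]
      exact ⟨Finset.mem_univ _, (lt_of_lt_of_le (lt_of_le_of_ne (h0 i) (Ne.symm hne)) (hμ hj)).ne'⟩
    have := Finset.card_le_card hsub
    rw [hm, Fin.card_Iic] at this
    omega

/-! ### Entropy under changes of variables and independence -/

section Entropy

variable {Ω E F : Type*} [MeasurableSpace Ω] [MeasureSpace E] [MeasureSpace F] {P : Measure Ω}

lemma pdf_id_of_hasLaw {Z : Ω → E} {μ : Measure E} (hZ : HasLaw Z μ P) :
    pdf id μ volume = pdf Z P volume := by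
  rw [pdf_def, pdf_def, hZ.map_eq, Measure.map_id]

lemma measurable_log_pdf (Z : Ω → E) :
    Measurable fun z => Real.log (pdf Z P volume z).toReal :=
  (measurable_pdf Z P volume).ennreal_toReal.log

/-- The entropy depends only on the law. -/
lemma entropy_eq_of_hasLaw {Z : Ω → E} {μ : Measure E} (hZ : HasLaw Z μ P) :
    entropy P Z = entropy μ id := by
  unfold entropy
  rw [pdf_id_of_hasLaw hZ]
  conv_rhs => rw [← hZ.map_eq]
  exact (integral_map hZ.aemeasurable
    (measurable_log_pdf (P := P) Z).neg.aestronglyMeasurable).symm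

lemma hasFiniteEntropy_iff_of_hasLaw {Z : Ω → E} {μ : Measure E} (hZ : HasLaw Z μ P) :
    HasFiniteEntropy P Z ↔ HasFiniteEntropy μ id := by
  unfold HasFiniteEntropy
  refine and_congr ?_ ?_
  · rw [hasPDF_iff_of_aemeasurable hZ.aemeasurable, hasPDF_iff_of_aemeasurable aemeasurable_id,
      hZ.map_eq, Measure.map_id]
  · rw [pdf_id_of_hasLaw hZ]
    conv_rhs => rw [← hZ.map_eq]
    exact (integrable_map_measure (measurable_log_pdf (P := P) Z).aestronglyMeasurable
      hZ.aemeasurable).symm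

lemma pdf_comp_ae_eq [IsFiniteMeasure P] {Z : Ω → E} (hZ : AEMeasurable Z P) {f : E → ENNReal}
    (hf : Measurable f) (h : P.map Z = volume.withDensity f) :
    HasPDF Z P volume ∧ ∀ᵐ ω ∂P, pdf Z P volume (Z ω) = f (Z ω) := by
  have hpdf : HasPDF Z P volume := hasPDF_of_map_eq_withDensity hZ f hf.aemeasurable h
  refine ⟨hpdf, ?_⟩
  have h1 := (pdf.eq_of_map_eq_withDensity f hf.aemeasurable).1 h
  exact ae_of_ae_map hZ (hpdf.absolutelyContinuous h1)

/-- The law of `Z` does not charge the zeros of its own density. This allows logarithms of products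
of densities to be split almost surely. -/
lemma pdf_comp_ae_pos [IsFiniteMeasure P] {Z : Ω → E} (hZ : HasPDF Z P volume) :
    ∀ᵐ ω ∂P, 0 < (pdf Z P volume (Z ω)).toReal := by
  have hm : AEMeasurable Z P := HasPDF.aemeasurable Z P volume
  have h1 : ∀ᵐ z ∂(P.map Z), pdf Z P volume z ≠ 0 := by
    rw [map_eq_withDensity_pdf Z P volume, ae_withDensity_iff (measurable_pdf Z P volume)]
    exact ae_of_all _ fun _ h => h
  have h2 : ∀ᵐ z ∂(P.map Z), pdf Z P volume z < ⊤ :=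
    hZ.absolutelyContinuous pdf.ae_lt_top
  filter_upwards [ae_of_ae_map hm h1, ae_of_ae_map hm h2] with ω h1 h2
  exact ENNReal.toReal_pos h1 h2.ne

lemma map_withDensity_of_leftInverse {μ : Measure E} {T : E → F} {S : F → E} (hT : Measurable T)
    (hS : Measurable S) (hST : Function.LeftInverse S T) {f : E → ENNReal} (hf : Measurable f) :
    (μ.withDensity f).map T = (μ.map T).withDensity (f ∘ S) := by
  ext s hs
  rw [Measure.map_apply hT hs, withDensity_apply _ (hT hs), withDensity_apply _ hs,
    setLIntegral_map hs (hf.comp hS) hT]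
  simp [hST _]

/-- The density of `T Z` is `c` times that of `Z` composed with `S`; `c` plays the role of the
inverse Jacobian determinant of `T`. -/
lemma log_pdf_transform [IsFiniteMeasure P] {Z : Ω → E} (hZ : HasPDF Z P volume) {T : E → F}
    {S : F → E} (hT : Measurable T) (hS : Measurable S) (hST : Function.LeftInverse S T)
    {c : ENNReal} (hc0 : c ≠ 0) (hc : c ≠ ⊤)
    (hmap : (volume : Measure E).map T = c • (volume : Measure F)) :
    HasPDF (fun ω => T (Z ω)) P volume ∧
      (fun ω => Real.log (pdf (fun ω => T (Z ω)) P volume (T (Z ω))).toReal) =ᵐ[P]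
        fun ω => Real.log c.toReal + Real.log (pdf Z P volume (Z ω)).toReal := by
  have hm : AEMeasurable Z P := HasPDF.aemeasurable Z P volume
  have hf := measurable_pdf Z P volume
  have hlaw : P.map (fun ω => T (Z ω)) =
      volume.withDensity (c • (pdf Z P volume ∘ S)) := by
    have h1 : P.map (fun ω => T (Z ω)) = (P.map Z).map T :=
      (AEMeasurable.map_map_of_aemeasurable hT.aemeasurable hm).symm
    rw [h1, map_eq_withDensity_pdf Z P volume, map_withDensity_of_leftInverse hT hS hST hf, hmap,
      withDensity_smul_measure, withDensity_smul _ (hf.comp hS)]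
  obtain ⟨h1, h2⟩ := pdf_comp_ae_eq (hT.comp_aemeasurable hm) ((hf.comp hS).const_smul c) hlaw
  refine ⟨h1, ?_⟩
  filter_upwards [h2, pdf_comp_ae_pos hZ] with ω h2 h3
  have h4 : pdf (fun ω => T (Z ω)) P volume (T (Z ω)) = c * pdf Z P volume (Z ω) := by
    refine h2.trans ?_
    simp [hST _]
  rw [h4, ENNReal.toReal_mul]
  exact Real.log_mul (ENNReal.toReal_pos hc0 hc).ne' h3.ne'

lemma HasFiniteEntropy.transform [IsProbabilityMeasure P] {Z : Ω → E} (hZ : HasFiniteEntropy P Z)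
    {T : E → F} {S : F → E} (hT : Measurable T) (hS : Measurable S)
    (hST : Function.LeftInverse S T) {c : ENNReal} (hc0 : c ≠ 0) (hc : c ≠ ⊤)
    (hmap : (volume : Measure E).map T = c • (volume : Measure F)) :
    HasFiniteEntropy P (fun ω => T (Z ω)) ∧
      entropy P (fun ω => T (Z ω)) = entropy P Z - Real.log c.toReal := by
  obtain ⟨h1, h2⟩ := log_pdf_transform hZ.1 hT hS hST hc0 hc hmap
  refine ⟨⟨h1, ((integrable_const _).add hZ.2).congr h2.symm⟩, ?_⟩
  unfold entropy
  rw [integral_neg, integral_neg, integral_congr_ae h2, integral_add (integrable_const _) hZ.2]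
  simp
  ring

lemma HasFiniteEntropy.prodMk [IsProbabilityMeasure P] [SigmaFinite (volume : Measure E)]
    [SigmaFinite (volume : Measure F)] {Z : Ω → E} {Z' : Ω → F}
    (hZ : HasFiniteEntropy P Z) (hZ' : HasFiniteEntropy P Z') (hind : IndepFun Z Z' P) :
    HasFiniteEntropy P (fun ω => (Z ω, Z' ω)) ∧
      entropy P (fun ω => (Z ω, Z' ω)) = entropy P Z + entropy P Z' := by
  have i1 := hZ.1
  have i2 := hZ'.1
  have hm : AEMeasurable Z P := HasPDF.aemeasurable Z P volume
  have hm' : AEMeasurable Z' P := HasPDF.aemeasurable Z' P volume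
  have hf := measurable_pdf Z P volume
  have hg := measurable_pdf Z' P volume
  have hlaw : P.map (fun ω => (Z ω, Z' ω)) =
      volume.withDensity (fun z : E × F => pdf Z P volume z.1 * pdf Z' P volume z.2) := by
    rw [(indepFun_iff_map_prod_eq_prod_map_map hm hm').1 hind]
    conv_lhs => rw [map_eq_withDensity_pdf Z P volume, map_eq_withDensity_pdf Z' P volume]
    have : SigmaFinite ((volume : Measure F).withDensity (pdf Z' P volume)) := by
      rw [← map_eq_withDensity_pdf Z' P volume]
      infer_instance
    rw [prod_withDensity hf hg]
    rfl
  obtain ⟨h1, h2⟩ := pdf_comp_ae_eq (hm.prodMk hm')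
    ((hf.comp measurable_fst).mul (hg.comp measurable_snd)) hlaw
  have h3 : (fun ω => Real.log (pdf (fun ω => (Z ω, Z' ω)) P volume (Z ω, Z' ω)).toReal) =ᵐ[P]
      fun ω => Real.log (pdf Z P volume (Z ω)).toReal + Real.log (pdf Z' P volume (Z' ω)).toReal := by
    filter_upwards [h2, pdf_comp_ae_pos i1, pdf_comp_ae_pos i2] with ω h2 h3 h4
    rw [h2]
    simp only [Pi.mul_apply, Function.comp_apply, ENNReal.toReal_mul]
    exact Real.log_mul h3.ne' h4.ne'
  refine ⟨⟨h1, (hZ.2.add hZ'.2).congr h3.symm⟩, ?_⟩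
  unfold entropy
  rw [integral_neg, integral_neg, integral_neg, integral_congr_ae h3, integral_add hZ.2 hZ'.2]
  ring

end Entropy

/-! ### Entropy of Gaussian vectors -/

lemma pi_gaussianReal_eq_withDensity (d : ℕ) :
    Measure.pi (fun _ : Fin d => gaussianReal 0 1) =
      volume.withDensity (fun x => ENNReal.ofReal (∏ i, gaussianPDFReal 0 1 (x i))) := by
  refine (Measure.pi_eq fun s hs => ?_)
  rw [withDensity_apply _ (MeasurableSet.univ_pi hs), volume_pi, Measure.restrict_pi_pi,
    ← ofReal_integral_eq_lintegral_ofReal, integral_fintype_prod_eq_prod (𝕜 := ℝ)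
      (f := fun _ x => gaussianPDFReal 0 1 x),
    ENNReal.ofReal_prod_of_nonneg]
  · refine Finset.prod_congr rfl fun i _ => ?_
    rw [gaussianReal_apply_eq_integral _ one_ne_zero]
  · exact fun i _ => integral_nonneg fun x => gaussianPDFReal_nonneg _ _ _
  · exact Integrable.fintype_prod (𝕜 := ℝ) (f := fun _ x => gaussianPDFReal 0 1 x)
      fun i => (integrable_gaussianPDFReal 0 1).restrict
  · exact ae_of_all _ fun x => Finset.prod_nonneg fun i _ => gaussianPDFReal_nonneg _ _ _

lemma log_gaussianPDFReal_zero_one (x : ℝ) :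
    Real.log (gaussianPDFReal 0 1 x) = Real.log (√(2 * Real.pi))⁻¹ - x ^ 2 / 2 := by
  rw [gaussianPDFReal_def, Real.log_mul (by positivity) (Real.exp_pos _).ne', Real.log_exp]
  simp
  ring

lemma hasFiniteEntropy_pi_gaussianReal (d : ℕ) :
    HasFiniteEntropy (Measure.pi (fun _ : Fin d => gaussianReal 0 1)) id := by
  have hmeas : Measurable fun x : Fin d → ℝ => ENNReal.ofReal (∏ i, gaussianPDFReal 0 1 (x i)) :=
    (Finset.measurable_prod _ fun i _ =>
      (measurable_gaussianPDFReal 0 1).comp (measurable_pi_apply i)).ennreal_ofReal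
  obtain ⟨h1, h2⟩ := pdf_comp_ae_eq (P := Measure.pi (fun _ : Fin d => gaussianReal 0 1))
    (Z := id) aemeasurable_id hmeas (by rw [Measure.map_id, pi_gaussianReal_eq_withDensity])
  refine ⟨h1, ?_⟩
  have hint : Integrable (fun x : Fin d → ℝ => ∑ i, Real.log (gaussianPDFReal 0 1 (x i)))
      (Measure.pi (fun _ : Fin d => gaussianReal 0 1)) := by
    refine integrable_finsetSum _ fun i _ => ?_
    have : Integrable (fun x => Real.log (gaussianPDFReal 0 1 x)) (gaussianReal 0 1) := by
      simp only [log_gaussianPDFReal_zero_one]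
      exact (integrable_const _).sub ((memLp_id_gaussianReal 2).integrable_sq.div_const 2)
    exact integrable_comp_eval (μ := fun _ : Fin d => gaussianReal 0 1) (i := i) this
  refine hint.congr ?_
  filter_upwards [h2] with x h2
  rw [h2, ENNReal.toReal_ofReal (Finset.prod_nonneg fun i _ => gaussianPDFReal_nonneg _ _ _),
    Real.log_prod fun i _ => (gaussianPDFReal_pos _ _ _ one_ne_zero).ne']
  rfl

lemma hasFiniteEntropy_stdGaussian (d : ℕ) :
    HasFiniteEntropy (stdGaussian (EuclideanSpace ℝ (Fin d))) id := by
  have hmp := PiLp.volume_preserving_toLp (Fin d)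
  have h := ((hasFiniteEntropy_pi_gaussianReal d).transform (T := WithLp.toLp 2)
    (S := WithLp.ofLp) hmp.measurable (PiLp.volume_preserving_ofLp (Fin d)).measurable
    (fun _ => rfl) one_ne_zero ENNReal.one_ne_top (by rw [hmp.map_eq, one_smul])).1
  exact (hasFiniteEntropy_iff_of_hasLaw ⟨hmp.measurable.aemeasurable, map_pi_eq_stdGaussian⟩).1 h

open scoped MatrixOrder in
-- The map `x ↦ m + √C x` sends the standard Gaussian to this one and has Jacobian `√(det C)`. The
-- standard entropy is left unevaluated because it cancels in the mutual information.
lemma multivariateGaussian_entropy {d : ℕ} (m : EuclideanSpace ℝ (Fin d))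
    {C : Matrix (Fin d) (Fin d) ℝ} (hC : C.PosDef) :
    HasFiniteEntropy (multivariateGaussian m C) id ∧
      entropy (multivariateGaussian m C) id =
        entropy (stdGaussian (EuclideanSpace ℝ (Fin d))) id + Real.log C.det / 2 := by
  set A := toEuclideanCLM (𝕜 := ℝ) (CFC.sqrt C) with hA
  have hdet : LinearMap.det (A : EuclideanSpace ℝ (Fin d) →ₗ[ℝ] EuclideanSpace ℝ (Fin d)) =
      √C.det := by
    rw [hA, coe_toEuclideanCLM_eq_toEuclideanLin, LinearMap.det_toLpLin, hC.posSemidef.det_sqrt,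
      RCLike.sqrt_of_nonneg hC.det_pos.le]
    rfl
  have hpos : 0 < √C.det := Real.sqrt_pos.2 hC.det_pos
  have hdet0 : LinearMap.det (A : EuclideanSpace ℝ (Fin d) →ₗ[ℝ] EuclideanSpace ℝ (Fin d)) ≠ 0 := by
    rw [hdet]; exact hpos.ne'
  let e := (LinearMap.equivOfDetNeZero _ hdet0).toContinuousLinearEquiv
  have he : ∀ x, e x = A x := fun x => rfl
  have hT : Measurable fun x => m + A x := by fun_prop
  have hS : Measurable fun y => e.symm (y - m) := by fun_prop
  have hST : Function.LeftInverse (fun y => e.symm (y - m)) fun x => m + A x := by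
    intro x
    simp [← he]
  have hmap : (volume : Measure (EuclideanSpace ℝ (Fin d))).map (fun x => m + A x) =
      ENNReal.ofReal (√C.det)⁻¹ • volume := by
    have h1 := Measure.map_linearMap_addHaar_eq_smul_addHaar
      (volume : Measure (EuclideanSpace ℝ (Fin d))) hdet0
    rw [hdet, abs_of_pos (inv_pos.2 hpos)] at h1
    have h2 : (fun x => m + A x) = (fun x => m + x) ∘ A := rfl
    rw [h2, ← Measure.map_map (measurable_const_add m) A.continuous.measurable]
    change Measure.map _ (Measure.map (A : EuclideanSpace ℝ (Fin d) →ₗ[ℝ] EuclideanSpace ℝ (Fin d)) volume) = _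
    rw [h1, Measure.map_smul, map_add_left_eq_self]
  -- This pushforward is the definition of `multivariateGaussian`.
  have hlaw : HasLaw (fun x => m + A x) (multivariateGaussian m C)
      (stdGaussian (EuclideanSpace ℝ (Fin d))) := ⟨hT.aemeasurable, rfl⟩
  obtain ⟨h1, h2⟩ := (hasFiniteEntropy_stdGaussian d).transform hT hS hST
    (ENNReal.ofReal_pos.2 (inv_pos.2 hpos)).ne' ENNReal.ofReal_ne_top hmap
  refine ⟨(hasFiniteEntropy_iff_of_hasLaw hlaw).1 h1, ?_⟩
  rw [← entropy_eq_of_hasLaw hlaw]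
  refine h2.trans ?_
  rw [ENNReal.toReal_ofReal (inv_pos.2 hpos).le, Real.log_inv, Real.log_sqrt hC.det_pos.le]
  ring

lemma log_prod_castLE {n r : ℕ} (hr : r ≤ n) {d : Fin n → ℝ} (hd : ∀ i, 0 < d i) :
    Real.log (∏ j : Fin r, d (Fin.castLE hr j)) = ∑ i : Fin n with i.val < r, Real.log (d i) := by
  rw [Real.log_prod fun i _ => (hd _).ne']
  refine Finset.sum_bij (fun j _ => Fin.castLE hr j) (fun j _ => by simp)
    (fun a _ b _ h => Fin.castLE_injective hr h) (fun i hi => ?_) (fun _ _ => rfl)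
  exact ⟨⟨i, (Finset.mem_filter.1 hi).2⟩, Finset.mem_univ _, rfl⟩

/-! ### Linear images and sums of Gaussian vectors -/

lemma inner_toLp_mulVec {k d : ℕ} (A : Matrix (Fin k) (Fin d) ℝ) (x : EuclideanSpace ℝ (Fin d))
    (t : EuclideanSpace ℝ (Fin k)) :
    inner ℝ (WithLp.toLp 2 (A *ᵥ x.ofLp)) t = inner ℝ x (WithLp.toLp 2 (Aᵀ *ᵥ t.ofLp)) := by
  simp only [EuclideanSpace.inner_eq_star_dotProduct, star_trivial]
  rw [Matrix.dotProduct_mulVec, ← Matrix.mulVec_transpose]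

lemma measurable_toLp_mulVec {k d : ℕ} (A : Matrix (Fin k) (Fin d) ℝ) :
    Measurable fun x : EuclideanSpace ℝ (Fin d) =>
      (WithLp.toLp 2 (A *ᵥ x.ofLp) : EuclideanSpace ℝ (Fin k)) :=
  (LinearMap.continuous_of_finiteDimensional (Matrix.toLpLin 2 2 A)).measurable

lemma posSemidef_mul_mul_transpose {k d : ℕ} {C : Matrix (Fin d) (Fin d) ℝ} (hC : C.PosSemidef)
    (A : Matrix (Fin k) (Fin d) ℝ) : (A * C * Aᵀ).PosSemidef := by
  simpa using hC.mul_mul_conjTranspose_same A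

/-- The image may be degenerate and have no density, so the laws are compared through characteristic
functions. -/
lemma hasLaw_mulVec_multivariateGaussian {k d : ℕ} (A : Matrix (Fin k) (Fin d) ℝ)
    (m : EuclideanSpace ℝ (Fin d)) {C : Matrix (Fin d) (Fin d) ℝ} (hC : C.PosSemidef) :
    HasLaw (fun x : EuclideanSpace ℝ (Fin d) => WithLp.toLp 2 (A *ᵥ x.ofLp))
      (multivariateGaussian (WithLp.toLp 2 (A *ᵥ m.ofLp)) (A * C * Aᵀ))
      (multivariateGaussian m C) := by
  have hA := measurable_toLp_mulVec A
  refine ⟨hA.aemeasurable, Measure.ext_of_charFun ?_⟩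
  ext t
  rw [charFun_multivariateGaussian (posSemidef_mul_mul_transpose hC A), charFun_apply,
    integral_map hA.aemeasurable (by fun_prop)]
  simp only [inner_toLp_mulVec]
  rw [← charFun_apply, charFun_multivariateGaussian hC]
  congr 2
  · rw [real_inner_comm, real_inner_comm _ t, inner_toLp_mulVec]
  · have : (Aᵀ *ᵥ t.ofLp) ⬝ᵥ C *ᵥ (Aᵀ *ᵥ t.ofLp) = t.ofLp ⬝ᵥ (A * C * Aᵀ) *ᵥ t.ofLp := by
      rw [← Matrix.mulVec_mulVec, ← Matrix.mulVec_mulVec, Matrix.dotProduct_mulVec t.ofLp A,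
        ← Matrix.mulVec_transpose]
    rw [this]

lemma gaussian_entropy {Ω : Type*} [MeasurableSpace Ω] {P : Measure Ω} {d : ℕ} {m : EuclideanSpace ℝ (Fin d)} {C : Matrix (Fin d) (Fin d) ℝ}
    (hC : C.PosDef) {Z : Ω → EuclideanSpace ℝ (Fin d)}
    (hZ : HasLaw Z (multivariateGaussian m C) P) :
    HasFiniteEntropy P Z ∧ entropy P Z =
      entropy (stdGaussian (EuclideanSpace ℝ (Fin d))) id + Real.log C.det / 2 := by
  rw [hasFiniteEntropy_iff_of_hasLaw hZ, entropy_eq_of_hasLaw hZ]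
  exact multivariateGaussian_entropy m hC

lemma reduced_linearModel {Ω : Type*} {n q r : ℕ} (B : Matrix (Fin n) (Fin q) ℝ)
    (X : Ω → EuclideanSpace ℝ (Fin q)) (ε : Ω → EuclideanSpace ℝ (Fin n))
    (U : Matrix (Fin n) (Fin r) ℝ) :
    reduced U (linearModel B X ε) = fun ω =>
      WithLp.toLp 2 (Uᵀ *ᵥ (ε ω).ofLp) + WithLp.toLp 2 ((Uᵀ * B) *ᵥ (X ω).ofLp) := by
  funext ω
  simp only [reduced, linearModel, WithLp.ofLp_add, Matrix.mulVec_add, WithLp.toLp_add,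
    Matrix.mulVec_mulVec]
  rw [add_comm]

lemma reduced_one {Ω : Type*} {n : ℕ} (Y : Ω → EuclideanSpace ℝ (Fin n)) : reduced 1 Y = Y := by
  funext ω
  simp [reduced]

lemma posDef_compression {n r : ℕ} {C : Matrix (Fin n) (Fin n) ℝ} (hC : C.PosDef)
    {U : Matrix (Fin n) (Fin r) ℝ} (hU : U.rank = r) : (Uᵀ * C * U).PosDef := by
  simpa using hC.conjTranspose_mul_mul_same (mulVec_injective_of_rank_eq hU)

variable {Ω : Type*} [MeasurableSpace Ω] {P : Measure Ω} [IsProbabilityMeasure P]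

lemma hasLaw_add_multivariateGaussian {d : ℕ} {m m' : EuclideanSpace ℝ (Fin d)}
    {C C' : Matrix (Fin d) (Fin d) ℝ} (hC : C.PosSemidef) (hC' : C'.PosSemidef)
    {Z Z' : Ω → EuclideanSpace ℝ (Fin d)} (hZ : HasLaw Z (multivariateGaussian m C) P)
    (hZ' : HasLaw Z' (multivariateGaussian m' C') P) (hind : IndepFun Z Z' P) :
    HasLaw (fun ω => Z ω + Z' ω) (multivariateGaussian (m + m') (C + C')) P := by
  refine ⟨hZ.aemeasurable.add hZ'.aemeasurable, Measure.ext_of_charFun ?_⟩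
  rw [hind.charFun_map_fun_add_eq_mul hZ.aemeasurable hZ'.aemeasurable, hZ.map_eq, hZ'.map_eq]
  ext t
  rw [Pi.mul_apply, charFun_multivariateGaussian hC, charFun_multivariateGaussian hC',
    charFun_multivariateGaussian (hC.add hC'), ← Complex.exp_add, inner_add_right, add_mulVec,
    dotProduct_add]
  congr 1
  push_cast
  ring

/-! ### Mutual information in the linear model -/

lemma measurePreserving_shear {k d : ℕ} (D : Matrix (Fin k) (Fin d) ℝ) :
    MeasurePreserving (fun p : EuclideanSpace ℝ (Fin k) × EuclideanSpace ℝ (Fin d) =>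
      (p.1 + WithLp.toLp 2 (D *ᵥ p.2.ofLp), p.2)) volume volume := by
  have hD := measurable_toLp_mulVec D
  -- For fixed second component the shear is a translation. `skew_product` puts the base first,
  -- hence the two swaps below.
  have h := (MeasurePreserving.id (volume : Measure (EuclideanSpace ℝ (Fin d)))).skew_product
    (μc := (volume : Measure (EuclideanSpace ℝ (Fin k))))
    (g := fun x w => w + WithLp.toLp 2 (D *ᵥ x.ofLp))
    (measurable_snd.add (hD.comp measurable_fst))
    (ae_of_all _ fun x => map_add_right_eq_self _ _)
  exact (Measure.measurePreserving_swap.comp h).comp Measure.measurePreserving_swap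

/-- The joint entropy of `D X + N` and `X` for independent `X` and `N`. -/
lemma HasFiniteEntropy.shear {k d : ℕ} (D : Matrix (Fin k) (Fin d) ℝ)
    {N : Ω → EuclideanSpace ℝ (Fin k)} {X : Ω → EuclideanSpace ℝ (Fin d)}
    (hN : HasFiniteEntropy P N) (hX : HasFiniteEntropy P X) (hind : IndepFun N X P) :
    HasFiniteEntropy P (fun ω => (N ω + WithLp.toLp 2 (D *ᵥ (X ω).ofLp), X ω)) ∧
      entropy P (fun ω => (N ω + WithLp.toLp 2 (D *ᵥ (X ω).ofLp), X ω)) =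
        entropy P N + entropy P X := by
  obtain ⟨h1, h2⟩ := hN.prodMk hX hind
  have hT := measurePreserving_shear D
  have hS : Measurable fun p : EuclideanSpace ℝ (Fin k) × EuclideanSpace ℝ (Fin d) =>
      (p.1 - WithLp.toLp 2 (D *ᵥ p.2.ofLp), p.2) :=
    (measurable_fst.sub ((measurable_toLp_mulVec D).comp measurable_snd)).prodMk measurable_snd
  obtain ⟨h3, h4⟩ := h1.transform hT.measurable hS (fun p => by simp) one_ne_zero
    ENNReal.one_ne_top (by rw [hT.map_eq, one_smul])
  refine ⟨h3, h4.trans ?_⟩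
  rw [h2]
  simp

section LinearModel

variable {n q r : ℕ} {B : Matrix (Fin n) (Fin q) ℝ}
  {mX : EuclideanSpace ℝ (Fin q)} {CX : Matrix (Fin q) (Fin q) ℝ}
  {mE : EuclideanSpace ℝ (Fin n)} {CE : Matrix (Fin n) (Fin n) ℝ}
  {X : Ω → EuclideanSpace ℝ (Fin q)} {ε : Ω → EuclideanSpace ℝ (Fin n)}

/-- The entropies and the mutual information of the reduced observations and the parameter. -/
lemma mutualInfo_reduced_linearModel (hCX : CX.PosDef) (hCE : CE.PosDef)
    (hX : HasLaw X (multivariateGaussian mX CX) P) (hε : HasLaw ε (multivariateGaussian mE CE) P)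
    (hXε : IndepFun X ε P) {U : Matrix (Fin n) (Fin r) ℝ} (hU : U.rank = r) :
    HasFiniteEntropy P (reduced U (linearModel B X ε)) ∧
      HasFiniteEntropy P (fun ω => (reduced U (linearModel B X ε) ω, X ω)) ∧
      mutualInfo P (reduced U (linearModel B X ε)) X =
        (Real.log (Uᵀ * (B * CX * Bᵀ + CE) * U).det - Real.log (Uᵀ * CE * U).det) / 2 := by
  have hN := (hasLaw_mulVec_multivariateGaussian Uᵀ mE hCE.posSemidef).comp hε
  have hDX := (hasLaw_mulVec_multivariateGaussian (Uᵀ * B) mX hCX.posSemidef).comp hX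
  rw [Matrix.transpose_transpose] at hN
  have hNpd := posDef_compression hCE hU
  have hA := posSemidef_mul_mul_transpose hCX.posSemidef B
  have hDpsd := posSemidef_mul_mul_transpose hCX.posSemidef (Uᵀ * B)
  have hW := hasLaw_add_multivariateGaussian hNpd.posSemidef hDpsd hN hDX
    (hXε.symm.comp (measurable_toLp_mulVec Uᵀ) (measurable_toLp_mulVec (Uᵀ * B)))
  have hcov : Uᵀ * CE * U + Uᵀ * B * CX * (Uᵀ * B)ᵀ = Uᵀ * (B * CX * Bᵀ + CE) * U := by
    rw [Matrix.mul_add, Matrix.add_mul, add_comm]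
    simp only [Matrix.transpose_mul, Matrix.transpose_transpose, Matrix.mul_assoc]
  rw [hcov] at hW
  obtain ⟨w1, w2⟩ := gaussian_entropy (posDef_compression (hCE.posSemidef_add hA) hU) hW
  obtain ⟨e1, e2⟩ := gaussian_entropy hNpd hN
  obtain ⟨x1, -⟩ := gaussian_entropy hCX hX
  obtain ⟨j1, j2⟩ := HasFiniteEntropy.shear (Uᵀ * B) e1 x1
    (hXε.symm.comp (measurable_toLp_mulVec Uᵀ) measurable_id)
  rw [reduced_linearModel]
  refine ⟨w1, j1, ?_⟩
  -- `H(X)` and the standard Gaussian entropy in dimension `r` both cancel.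
  refine (congrArg₂ (· - ·) (congrArg (· + entropy P X) w2) j2).trans ?_
  simp only [e2]
  ring

end LinearModel

/-- The maximal mutual information between `r` linear observations and the parameter. -/
lemma IsMIOptimal.mutualInfo_eq {n q r : ℕ} {B : Matrix (Fin n) (Fin q) ℝ}
    {mX : EuclideanSpace ℝ (Fin q)} {CX : Matrix (Fin q) (Fin q) ℝ} (hCX : CX.PosDef)
    {mE : EuclideanSpace ℝ (Fin n)} {CE : Matrix (Fin n) (Fin n) ℝ} (hCE : CE.PosDef)
    {X : Ω → EuclideanSpace ℝ (Fin q)} {ε : Ω → EuclideanSpace ℝ (Fin n)}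
    (hX : HasLaw X (multivariateGaussian mX CX) P) (hε : HasLaw ε (multivariateGaussian mE CE) P)
    (hXε : IndepFun X ε P) {M : Matrix (Fin n) (Fin n) ℝ} {d : Fin n → ℝ} (hd : Antitone d)
    (hpos : ∀ i, 0 < d i) (hE : Mᵀ * CE * M = 1) (hY : Mᵀ * (B * CX * Bᵀ + CE) * M = diagonal d)
    {V : Matrix (Fin n) (Fin r) ℝ} (hV : IsMIOptimal P (linearModel B X ε) X V) :
    mutualInfo P (reduced V (linearModel B X ε)) X =
      (∑ i : Fin n with i.val < r, Real.log (d i)) / 2 := by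
  obtain ⟨hVr, hmax⟩ := hV
  -- Optimality includes rank `r`, which forces `r ≤ n`.
  have hr : r ≤ n := hVr ▸ V.rank_le_height
  have hYpd := hCE.posSemidef_add (posSemidef_mul_mul_transpose hCX.posSemidef B)
  rw [← log_prod_castLE hr hpos]
  refine le_antisymm ?_ ?_
  · obtain ⟨-, -, h⟩ := mutualInfo_reduced_linearModel (B := B) hCX hCE hX hε hXε hVr
    rw [h]
    have hVE := (posDef_compression hCE hVr).det_pos
    have hle := Real.log_le_log (posDef_compression hYpd hVr).det_pos
      (det_compression_le hd (fun i => (hpos i).le) hE hY hr V)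
    rw [Real.log_mul (Finset.prod_pos fun i _ => hpos _).ne' hVE.ne'] at hle
    linarith
  · obtain ⟨U, hU, h1, h2⟩ := exists_det_compression_eq hE hY hr
    obtain ⟨-, -, h⟩ := mutualInfo_reduced_linearModel (B := B) hCX hCE hX hε hXε hU
    rw [h1, h2, Real.log_one, sub_zero] at h
    rw [← h]
    exact hmax hU

/-- The mutual information between all observations and the parameter. -/
lemma mutualInfo_linearModel {n q : ℕ} {B : Matrix (Fin n) (Fin q) ℝ}
    {mX : EuclideanSpace ℝ (Fin q)} {CX : Matrix (Fin q) (Fin q) ℝ} (hCX : CX.PosDef)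
    {mE : EuclideanSpace ℝ (Fin n)} {CE : Matrix (Fin n) (Fin n) ℝ} (hCE : CE.PosDef)
    {X : Ω → EuclideanSpace ℝ (Fin q)} {ε : Ω → EuclideanSpace ℝ (Fin n)}
    (hX : HasLaw X (multivariateGaussian mX CX) P) (hε : HasLaw ε (multivariateGaussian mE CE) P)
    (hXε : IndepFun X ε P) {M : Matrix (Fin n) (Fin n) ℝ} {d : Fin n → ℝ} (hpos : ∀ i, 0 < d i)
    (hE : Mᵀ * CE * M = 1) (hY : Mᵀ * (B * CX * Bᵀ + CE) * M = diagonal d) :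
    mutualInfo P (linearModel B X ε) X = (∑ i, Real.log (d i)) / 2 := by
  have hYpd := hCE.posSemidef_add (posSemidef_mul_mul_transpose hCX.posSemidef B)
  obtain ⟨-, -, h⟩ := mutualInfo_reduced_linearModel (B := B) (U := 1) hCX hCE hX hε hXε
    (by rw [Matrix.rank_one, Fintype.card_fin])
  simp only [reduced_one, Matrix.transpose_one, Matrix.one_mul, Matrix.mul_one] at h
  rw [h, ← Real.log_prod fun i _ => (hpos i).ne']
  have h1 := congrArg det hE
  have h2 := congrArg det hY
  simp only [det_mul, det_transpose, det_one, det_diagonal] at h1 h2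
  have hE0 := hCE.det_pos
  have hY0 := hYpd.det_pos
  rw [← Real.log_div hY0.ne' hE0.ne']
  congr 2
  rw [div_eq_iff hE0.ne', ← h2]
  -- `h1` says `(det M)² det C_E = 1`, so the squared determinant of `M` drops out of the ratio.
  linear_combination (-(B * CX * Bᵀ + CE).det) * h1

end GaussianReduction

/-! ### The relative error -/

theorem corollary2 {Ω : Type*} [MeasurableSpace Ω] (P : Measure Ω) [IsProbabilityMeasure P]
    (n q r m : ℕ)
    (B : Matrix (Fin n) (Fin q) ℝ)
    (mX : EuclideanSpace ℝ (Fin q)) (CX : Matrix (Fin q) (Fin q) ℝ) (hCX : CX.PosDef)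
    (mE : EuclideanSpace ℝ (Fin n)) (CE : Matrix (Fin n) (Fin n) ℝ) (hCE : CE.PosDef)
    (X : Ω → EuclideanSpace ℝ (Fin q)) (ε : Ω → EuclideanSpace ℝ (Fin n))
    (hX : HasLaw X (multivariateGaussian mX CX) P)
    (hε : HasLaw ε (multivariateGaussian mE CE) P)
    (hXε : IndepFun X ε P)
    (Y : Ω → EuclideanSpace ℝ (Fin n)) (hY : Y = linearModel B X ε)
    (CA CY : Matrix (Fin n) (Fin n) ℝ) (hCA : CA = B * CX * Bᵀ) (hCY : CY = CA + CE)
    (lam ν : Fin n → ℝ)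
    (hlam : IsSortedGenEigenvalues CY CE lam) (hν : IsSortedGenEigenvalues CA CE ν)
    (hm : B.rank = m)
    (V : Matrix (Fin n) (Fin r) ℝ) (hV : IsMIOptimal P Y X V)
    (W : Ω → EuclideanSpace ℝ (Fin r)) (hW : W = reduced V Y) :
    -- all the entropies involved, also those in the maximization over `V`, are well defined
    (HasFiniteEntropy P X ∧ HasFiniteEntropy P Y ∧ HasFiniteEntropy P (fun ω => (Y ω, X ω)) ∧
      ∀ U : Matrix (Fin n) (Fin r) ℝ, U.rank = r →
        HasFiniteEntropy P (reduced U Y) ∧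
        HasFiniteEntropy P (fun ω => (reduced U Y ω, X ω))) ∧
    (m ≤ q ∧ CA.rank = m) ∧
    (∀ i, 0 ≤ ν i ∧ lam i = 1 + ν i) ∧
    -- the relative error; for `m = 0` it would be `0 / 0`
    (0 < m →
      0 < mutualInfo P Y X ∧
      0 < ∑ i : Fin n with i.val < m, Real.log (1 + ν i) ∧
      (mutualInfo P Y X - mutualInfo P W X) / mutualInfo P Y X =
        1 - (∑ i : Fin n with i.val < r, Real.log (1 + ν i)) /
            (∑ i : Fin n with i.val < m, Real.log (1 + ν i))) ∧
    (m ≤ r → mutualInfo P W X = mutualInfo P Y X) ∧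
    (r = q → mutualInfo P W X = mutualInfo P Y X) := by
  subst hY hCA hCY hW
  have hA : (B * CX * Bᵀ).PosSemidef := posSemidef_mul_mul_transpose hCX.posSemidef B
  -- `C_A + C_E` has the eigenvectors of `C_A`, with eigenvalues shifted by `1`; uniqueness then
  -- determines `lam`.
  have hlν : lam = fun i => 1 + ν i := hlam.unique (isUnit_iff_ne_zero.2 hCE.det_pos.ne') hν.add
  obtain ⟨M, hME, hMA⟩ := hν.exists_diagonalization hA.isHermitian hCE
  have hν0 : ∀ i, 0 ≤ ν i := by
    have hpsd : (Mᵀ * (B * CX * Bᵀ) * M).PosSemidef := by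
      simpa using hA.conjTranspose_mul_mul_same M
    rw [hMA, Matrix.posSemidef_diagonal_iff] at hpsd
    exact hpsd
  have hrank : (B * CX * Bᵀ).rank = m := (rank_mul_mul_transpose_of_posDef B hCX).trans hm
  have hzero : ∀ i, ν i = 0 ↔ m ≤ i := eq_zero_iff_of_antitone_of_card hν.1 hν0
    ((rank_eq_card_of_diagonalization (Matrix.isUnit_det_of_left_inverse hME) hMA).symm.trans hrank)
  have hmn : m ≤ n := hrank ▸ Matrix.rank_le_height _
  have hmq : m ≤ q := hm ▸ B.rank_le_width
  have hpos : ∀ i, 0 < 1 + ν i := fun i => by linarith [hν0 i]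
  have hMY : Mᵀ * (B * CX * Bᵀ + CE) * M = diagonal fun i => 1 + ν i := by
    rw [Matrix.mul_add, Matrix.add_mul, hMA, hME, ← diagonal_one, diagonal_add]
    congr 1
    funext i
    exact add_comm _ _
  -- Beyond the first `m` indices every term is `log 1 = 0`.
  have hfull : ∀ k, m ≤ k → ∑ i : Fin n with i.val < k, Real.log (1 + ν i) =
      ∑ i : Fin n with i.val < m, Real.log (1 + ν i) := by
    intro k hk
    refine (Finset.sum_subset (fun i hi => ?_) fun i _ hi => ?_).symm
    · simp only [Finset.mem_filter, Finset.mem_univ, true_and] at hi ⊢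
      omega
    · rw [(hzero i).2 (by simpa using hi), add_zero, Real.log_one]
  have hIY : mutualInfo P (linearModel B X ε) X =
      (∑ i : Fin n with i.val < m, Real.log (1 + ν i)) / 2 := by
    rw [mutualInfo_linearModel hCX hCE hX hε hXε hpos hME hMY, ← hfull n hmn]
    simp
  have hIW := hV.mutualInfo_eq hCX hCE hX hε hXε
    (fun i j hij => add_le_add_right (hν.1 hij) 1) hpos hME hMY
  have heq : m ≤ r → mutualInfo P (reduced V (linearModel B X ε)) X =
      mutualInfo P (linearModel B X ε) X := by
    intro hmr
    rw [hIW, hIY, hfull r hmr]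
  obtain ⟨y1, y2, -⟩ := mutualInfo_reduced_linearModel (B := B) (U := 1) hCX hCE hX hε hXε
    (by rw [Matrix.rank_one, Fintype.card_fin])
  rw [reduced_one] at y1 y2
  refine ⟨⟨(gaussian_entropy hCX hX).1, y1, y2, fun U hU => ?_⟩, ⟨hmq, hrank⟩,
    fun i => ⟨hν0 i, congrFun hlν i⟩, fun hm0 => ?_, heq, fun hrq => heq (hrq ▸ hmq)⟩
  · obtain ⟨u1, u2, -⟩ := mutualInfo_reduced_linearModel (B := B) hCX hCE hX hε hXε hU
    exact ⟨u1, u2⟩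
  · have hs : 0 < ∑ i : Fin n with i.val < m, Real.log (1 + ν i) := by
      -- Index `0` makes the sum nonempty, as `0 < m ≤ n`; each `ν i` with `i < m` is nonzero, hence
      -- positive.
      refine Finset.sum_pos (fun i hi => Real.log_pos ?_) ⟨⟨0, by omega⟩, by simpa using hm0⟩
      have hi' : i.val < m := (Finset.mem_filter.1 hi).2
      have := lt_of_le_of_ne (hν0 i) (fun h => absurd ((hzero i).1 h.symm) (by omega))
      linarith
    refine ⟨by rw [hIY]; linarith, hs, ?_⟩
    rw [hIW, hIY]
    field_simp
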